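/- For each positive integer $n$, consider the following two-party communication problem $\textsc{Matching}_n$. Fix two disjoint vertex sets $X$ and $Y$ of size $n$, known to both parties. Alice receives a set $E_A \subseteq X \times Y$ and Bob receives a set $E_B \subseteq X \times Y$ (the two sets may overlap), and they must decide whether the $n\times n$ bipartite graph $G=(X\cup Y,\,E_A\cup E_B)$ has a perfect matching. Let $D(\textsc{Matching}_n)$ be its deterministic communication complexity, i.e. the minimum, over all deterministic protocols (binary protocol trees in which at each inner node one party sends one bit depending on its own input and the bits exchanged so far, and each leaf is labelled with an output) that give the correct answer on all inputs, of the worst-case number of bits communicated. Theorem. $D(\textsc{Matching}_n) \le O(n^{3/2}\log n)$; that is, there is a constant $C>0$ such that for all $n\ge 2$, $D(\textsc{Matching}_n)\le C\, n^{3/2}\log n$. -/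

import Mathlib

open scoped ENNReal

/-- A deterministic two-party communication protocol with input sets `X` (Alice) and `Y` (Bob) and
output set `R`, as a binary protocol tree. At an inner node one fixed party sends one bit,
which is an arbitrary function of that party's own input (and of the node, i.e. of the bits
exchanged so far); the first subtree follows the bit `false`, the second one the bit `true`.
A leaf carries the output, which is thus determined by the transcript. -/
inductive CommProtocol (X Y R : Type*) where
  | leaf (r : R) : CommProtocol X Y R
  | alice (bit : X → Bool) (P₀ P₁ : CommProtocol X Y R) : CommProtocol X Y R
  | bob (bit : Y → Bool) (P₀ P₁ : CommProtocol X Y R) : CommProtocol X Y R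

namespace CommProtocol

variable {X Y R : Type*}

/-- The output of the protocol on the input pair `(x, y)`. -/
def output : CommProtocol X Y R → X → Y → R
  | leaf r, _, _ => r
  | alice bit P₀ P₁, x, y => if bit x then P₁.output x y else P₀.output x y
  | bob bit P₀ P₁, x, y => if bit y then P₁.output x y else P₀.output x y

/-- The worst-case number of bits communicated: the height of the protocol tree. -/
def cost : CommProtocol X Y R → ℕ
  | leaf _ => 0
  | alice _ P₀ P₁ => 1 + max P₀.cost P₁.cost
  | bob _ P₀ P₁ => 1 + max P₀.cost P₁.cost

/-- The protocol computes `f`: its output is correct on every pair of inputs. -/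
def Computes (P : CommProtocol X Y R) (f : X → Y → R) : Prop :=
  ∀ x y, P.output x y = f x y

end CommProtocol

/-- The deterministic communication complexity `D(f)`: the least cost of a protocol that
computes `f` (and `⊤` if there is none). -/
noncomputable def detCommComplexity {X Y R : Type*} (f : X → Y → R) : ℕ∞ :=
  ⨅ (P : CommProtocol X Y R) (_ : P.Computes f), (P.cost : ℕ∞)

/-- The `n × n` bipartite graph whose two vertex classes are two disjoint copies of
`{0, …, n - 1}` and in which the left vertex `i` is joined to the right vertex `j` exactly when
`(i, j) ∈ E`. -/
def bipartiteGraphOf {n : ℕ} (E : Finset (Fin n × Fin n)) : SimpleGraph (Fin n ⊕ Fin n) :=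
  SimpleGraph.fromEdgeSet {e | ∃ p ∈ E, e = s(Sum.inl p.1, Sum.inr p.2)}

open Classical in
/-- The problem `Matching_n`: Alice holds an edge set `EA`, Bob an edge set `EB` (they may overlap),
and the question is whether the graph with edge set `EA ∪ EB` has a perfect matching. -/
noncomputable def matchingProblem (n : ℕ) (EA EB : Finset (Fin n × Fin n)) : Bool :=
  decide (∃ M : (bipartiteGraphOf (EA ∪ EB)).Subgraph, M.IsPerfectMatching)

/-! The parties simulate an algorithm that accesses `A ∪ B` only through queries for an edge of
least weight, where the weights depend on a public state. A query costs `O(log n)` bits: each party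
sends its own best edge and the better one wins (`exists_query_protocol`).

An auction with prices capped at `k` uses at most `n * k` queries. By a linear programming duality
count (`AuctionInv.mul_card_unmatched_le`) it leaves at most `n / k` left vertices unmatched
whenever a perfect matching exists. The remaining vertices are handled by alternating search, at
most `n + 1` queries per augmentation; a search that gets stuck with a vertex still unmatched
exhibits a violation of Hall's condition (`SearchState.Inv.unmatched_eq_empty`). Taking `k =
Nat.sqrt n` balances the phases at `O(n^{3/2})` queries. -/

open Finset

/-! ### Composing protocols and sending messages. -/

namespace CommProtocol

variable {X Y R S : Type*}

/-- Run `P`, then continue with the protocol selected by its output. -/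
def bind : CommProtocol X Y R → (R → CommProtocol X Y S) → CommProtocol X Y S
  | leaf r, f => f r
  | alice bit P₀ P₁, f => alice bit (P₀.bind f) (P₁.bind f)
  | bob bit P₀ P₁, f => bob bit (P₀.bind f) (P₁.bind f)

theorem output_bind (P : CommProtocol X Y R) (f : R → CommProtocol X Y S) (x : X) (y : Y) :
    (P.bind f).output x y = (f (P.output x y)).output x y := by
  induction P with
  | leaf r => rfl
  | alice bit P₀ P₁ h₀ h₁ => simp only [bind, output]; split_ifs <;> assumption
  | bob bit P₀ P₁ h₀ h₁ => simp only [bind, output]; split_ifs <;> assumption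

theorem cost_bind_le (P : CommProtocol X Y R) (f : R → CommProtocol X Y S) {c : ℕ}
    (hf : ∀ r, (f r).cost ≤ c) : (P.bind f).cost ≤ P.cost + c := by
  induction P with
  | leaf r => simpa [bind, cost] using hf r
  | alice bit P₀ P₁ h₀ h₁ => simp only [bind, cost]; omega
  | bob bit P₀ P₁ h₀ h₁ => simp only [bind, cost]; omega

theorem exists_alice_send_nat (t : ℕ) (msg : X → ℕ) (hmsg : ∀ x, msg x < 2 ^ t) :
    ∃ P : CommProtocol X Y ℕ, P.cost ≤ t ∧ ∀ x y, P.output x y = msg x := by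
  induction t generalizing msg with
  | zero => exact ⟨leaf 0, le_rfl, fun x _ => by have := hmsg x; simp [output]; omega⟩
  | succ t ih =>
    obtain ⟨P, hc, hP⟩ := ih (fun x => msg x / 2) fun x => by
      have := hmsg x; rw [pow_succ] at this; omega
    refine ⟨alice (fun x => decide (msg x % 2 = 1)) (P.bind fun a => leaf (2 * a))
      (P.bind fun a => leaf (2 * a + 1)), ?_, fun x y => ?_⟩
    · have h₀ := P.cost_bind_le (fun a => (leaf (2 * a) : CommProtocol X Y ℕ)) fun _ => le_rfl
      have h₁ := P.cost_bind_le (fun a => (leaf (2 * a + 1) : CommProtocol X Y ℕ)) fun _ => le_rfl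
      simp only [cost] at h₀ h₁ ⊢
      omega
    · simp only [output, output_bind, hP, decide_eq_true_eq]
      split_ifs <;> omega

/-- The protocol with the roles of the two parties exchanged. -/
def swap : CommProtocol X Y R → CommProtocol Y X R
  | leaf r => leaf r
  | alice bit P₀ P₁ => bob bit P₀.swap P₁.swap
  | bob bit P₀ P₁ => alice bit P₀.swap P₁.swap

theorem output_swap (P : CommProtocol X Y R) (x : X) (y : Y) :
    P.swap.output y x = P.output x y := by
  induction P <;> simp_all [swap, output]

theorem cost_swap (P : CommProtocol X Y R) : P.swap.cost = P.cost := by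
  induction P <;> simp_all [swap, cost]

theorem exists_alice_send {A : Type*} [Fintype A] [Nonempty A] {t : ℕ}
    (ht : Fintype.card A ≤ 2 ^ t) (msg : X → A) :
    ∃ P : CommProtocol X Y A, P.cost ≤ t ∧ ∀ x y, P.output x y = msg x := by
  let enc : A → ℕ := fun a => Fintype.equivFin A a
  have henc : Function.Injective enc := Fin.val_injective.comp (Fintype.equivFin A).injective
  obtain ⟨P, hc, hP⟩ := exists_alice_send_nat (Y := Y) t (fun x => enc (msg x))
    fun x => (Fin.is_lt _).trans_le ht
  refine ⟨P.bind fun a => leaf (Function.invFun enc a),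
    (P.cost_bind_le _ (c := 0) fun _ => le_rfl).trans hc, fun x y => ?_⟩
  rw [output_bind, hP]
  exact Function.leftInverse_invFun henc _

theorem exists_bob_send {A : Type*} [Fintype A] [Nonempty A] {t : ℕ}
    (ht : Fintype.card A ≤ 2 ^ t) (msg : Y → A) :
    ∃ P : CommProtocol X Y A, P.cost ≤ t ∧ ∀ x y, P.output x y = msg y := by
  obtain ⟨P, hc, hP⟩ := exists_alice_send (Y := X) ht msg
  exact ⟨P.swap, P.cost_swap.trans_le hc, fun x y => (P.output_swap y x).trans (hP y x)⟩

/-- A state known to both parties is updated `N` times, each time after both parties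
send one message from `A`. -/
theorem exists_iterate {A : Type*} [Fintype A] [Nonempty A] {t : ℕ}
    (ht : Fintype.card A ≤ 2 ^ t) (msgA : S → X → A) (msgB : S → Y → A)
    (step : S → A → A → S) (N : ℕ) (s : S) :
    ∃ P : CommProtocol X Y S, P.cost ≤ N * (2 * t) ∧
      ∀ x y, P.output x y = (fun s => step s (msgA s x) (msgB s y))^[N] s := by
  choose PA hcA hPA using fun s => exists_alice_send (Y := Y) ht (msgA s)
  choose PB hcB hPB using fun s => exists_bob_send (X := X) ht (msgB s)
  induction N generalizing s with
  | zero => exact ⟨leaf s, by simp [cost], fun _ _ => rfl⟩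
  | succ N ih =>
    choose P hc hP using ih
    refine ⟨(PA s).bind fun a => (PB s).bind fun b => P (step s a b), ?_, fun x y => ?_⟩
    · refine (cost_bind_le _ _ (c := t + N * (2 * t)) fun a =>
        (cost_bind_le _ _ fun b => hc _).trans (Nat.add_le_add_right (hcB s) _)).trans ?_
      have := hcA s
      rw [Nat.succ_mul N (2 * t)]
      omega
    · rw [output_bind, output_bind, hP, hPA, hPB, Function.iterate_succ_apply]

end CommProtocol

/-! ### Simulating query algorithms. -/

/-- The protocol runs for a fixed number of rounds, so an algorithm that finishes early idles at a
fixed point. -/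
theorem Function.iterate_of_potential {S : Type*} (f : S → S) (Inv Done : S → Prop) (Φ : S → ℕ)
    (h : ∀ s, Inv s → (f s = s ∧ Done s) ∨ (Inv (f s) ∧ Φ (f s) < Φ s)) (N : ℕ) (s : S)
    (hs : Inv s) (hN : Φ s ≤ N) : Inv (f^[N] s) ∧ Done (f^[N] s) := by
  induction N generalizing s with
  | zero =>
    rcases h s hs with h' | h'
    · exact ⟨hs, h'.2⟩
    · omega
  | succ N ih =>
    rcases h s hs with h' | h'
    · rw [Function.iterate_fixed h'.1]
      exact ⟨hs, h'.2⟩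
    · rw [Function.iterate_succ_apply]
      exact ih _ h'.1 (by omega)

/-- `a` is an element of `E` of least finite weight, or `none` if there is none. -/
def IsMinElement {α : Type*} (E : Finset α) (w : α → ℕ∞) : Option α → Prop
  | none => ∀ e ∈ E, w e = ⊤
  | some e => e ∈ E ∧ w e ≠ ⊤ ∧ ∀ e' ∈ E, w e ≤ w e'

theorem exists_isMinElement {α : Type*} (E : Finset α) (w : α → ℕ∞) :
    ∃ a, IsMinElement E w a := by
  by_cases h : ∀ e ∈ E, w e = ⊤
  · exact ⟨none, h⟩
  · push Not at h
    obtain ⟨e₀, he₀, hw⟩ := h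
    obtain ⟨e, he, hmin⟩ := E.exists_min_image w ⟨e₀, he₀⟩
    exact ⟨some e, he, ne_top_of_le_ne_top hw (hmin _ he₀), hmin⟩

/-- The quantifier order matters: `c` depends only on `w` and the two messages, so both parties can
compute it without knowing `A` and `B`. -/
theorem exists_isMinElement_union {α : Type*} [DecidableEq α] (w : α → ℕ∞) (a b : Option α) :
    ∃ c, ∀ A B : Finset α, IsMinElement A w a → IsMinElement B w b → IsMinElement (A ∪ B) w c := by
  rcases a with _ | a
  · refine ⟨b, fun A B hA hB => ?_⟩
    rcases b with _ | b
    · intro e he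
      exact (mem_union.1 he).elim (hA e) (hB e)
    · refine ⟨mem_union_right _ hB.1, hB.2.1, fun e he => ?_⟩
      exact (mem_union.1 he).elim (fun h => (hA e h).symm ▸ le_top) (hB.2.2 e)
  · rcases b with _ | b
    · refine ⟨some a, fun A B hA hB => ⟨mem_union_left _ hA.1, hA.2.1, fun e he => ?_⟩⟩
      exact (mem_union.1 he).elim (hA.2.2 e) (fun h => (hB e h).symm ▸ le_top)
    · rcases le_total (w a) (w b) with h | h
      · exact ⟨some a, fun A B hA hB => ⟨mem_union_left _ hA.1, hA.2.1, fun e he =>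
          (mem_union.1 he).elim (hA.2.2 e) fun h' => h.trans (hB.2.2 e h')⟩⟩
      · exact ⟨some b, fun A B hA hB => ⟨mem_union_right _ hB.1, hB.2.1, fun e he =>
          (mem_union.1 he).elim (fun h' => h.trans (hA.2.2 e h')) (hB.2.2 e)⟩⟩

/-- Protocol simulation of an algorithm which accesses the union of the two input sets only
through queries for an element of least weight. -/
theorem exists_query_protocol {α S : Type*} [Fintype α] [DecidableEq α] {t : ℕ}
    (ht : Fintype.card (Option α) ≤ 2 ^ t) (w : S → α → ℕ∞) (step : S → Option α → S)
    (N : ℕ) (s : S) :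
    ∃ P : CommProtocol (Finset α) (Finset α) S, P.cost ≤ N * (2 * t) ∧
      ∀ A B, ∃ ans : S → Option α, (∀ s, IsMinElement (A ∪ B) (w s) (ans s)) ∧
        P.output A B = (fun s => step s (ans s))^[N] s := by
  choose msg hmsg using fun (s : S) (E : Finset α) => exists_isMinElement E (w s)
  choose comb hcomb using fun (s : S) => exists_isMinElement_union (w s)
  obtain ⟨P, hc, hP⟩ := CommProtocol.exists_iterate ht msg msg
    (fun s a b => step s (comb s a b)) N s
  exact ⟨P, hc, fun A B => ⟨fun s => comb s (msg s A) (msg s B),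
    fun s => hcomb s _ _ _ _ (hmsg s A) (hmsg s B), hP A B⟩⟩

/-! ### Perfect and partial matchings as functions on the left vertices. -/

section Matching

variable {n : ℕ}

/-- `σ` is a perfect matching of the bipartite graph with edge set `E`. -/
def IsPerfectMatchingFun (E : Finset (Fin n × Fin n)) (σ : Fin n → Fin n) : Prop :=
  Function.Injective σ ∧ ∀ i, (i, σ i) ∈ E

theorem exists_isPerfectMatching_iff (E : Finset (Fin n × Fin n)) :
    (∃ M : (bipartiteGraphOf E).Subgraph, M.IsPerfectMatching) ↔
      ∃ σ, IsPerfectMatchingFun E σ := by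
  have hadj : ∀ i b, (bipartiteGraphOf E).Adj (Sum.inl i) b → ∃ j, b = Sum.inr j ∧ (i, j) ∈ E := by
    rintro i b h
    rw [bipartiteGraphOf, SimpleGraph.fromEdgeSet_adj] at h
    obtain ⟨⟨p, hp, he⟩, -⟩ := h
    rw [Sym2.eq_iff] at he
    rcases he with ⟨h1, h2⟩ | ⟨h1, h2⟩
    · exact ⟨p.2, h2, by rwa [Sum.inl.inj h1]⟩
    · simp at h1
  constructor
  · rintro ⟨M, hM, hspan⟩
    have hex : ∀ i, ∃ j, M.Adj (Sum.inl i) (Sum.inr j) ∧ (i, j) ∈ E := fun i => by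
      obtain ⟨b, hb, -⟩ := hM (hspan (Sum.inl i))
      obtain ⟨j, rfl, hj⟩ := hadj i b hb.adj_sub
      exact ⟨j, hb, hj⟩
    choose σ hσ hE using hex
    refine ⟨σ, fun i i' h => ?_, hE⟩
    have h' := hσ i'
    rw [← h] at h'
    exact Sum.inl.inj ((hM (hspan (Sum.inr (σ i)))).unique (hσ i).symm h'.symm)
  · rintro ⟨σ, hσ, hE⟩
    have hbij : Function.Bijective σ := Finite.injective_iff_bijective.1 hσ
    refine ⟨{ verts := Set.univ
              Adj := fun a b => ∃ i, (a = Sum.inl i ∧ b = Sum.inr (σ i)) ∨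
                (b = Sum.inl i ∧ a = Sum.inr (σ i))
              adj_sub := ?_
              edge_vert := fun _ => Set.mem_univ _
              symm := ?_ }, ?_, fun _ => Set.mem_univ _⟩
    · rintro a b ⟨i, ⟨rfl, rfl⟩ | ⟨rfl, rfl⟩⟩
      · rw [bipartiteGraphOf, SimpleGraph.fromEdgeSet_adj]
        exact ⟨⟨_, hE i, rfl⟩, by simp⟩
      · rw [bipartiteGraphOf, SimpleGraph.fromEdgeSet_adj]
        exact ⟨⟨_, hE i, Sym2.eq_swap⟩, by simp⟩
    · constructor
      rintro a b ⟨i, h⟩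
      exact ⟨i, h.symm⟩
    · rintro (i | j) -
      · refine ⟨Sum.inr (σ i), ⟨i, Or.inl ⟨rfl, rfl⟩⟩, ?_⟩
        rintro b ⟨i', ⟨h, rfl⟩ | ⟨-, h⟩⟩
        · rw [Sum.inl.inj h]
        · simp at h
      · obtain ⟨i, rfl⟩ := hbij.2 j
        refine ⟨Sum.inl i, ⟨i, Or.inr ⟨rfl, rfl⟩⟩, ?_⟩
        rintro b ⟨i', ⟨h, -⟩ | ⟨rfl, h⟩⟩
        · simp at h
        · rw [hσ (Sum.inr.inj h)]

/-- `m` is a partial matching of the bipartite graph with edge set `E`. -/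
structure IsPartialMatching (E : Finset (Fin n × Fin n)) (m : Fin n → Option (Fin n)) : Prop where
  edge : ∀ u v, m u = some v → (u, v) ∈ E
  inj : ∀ u u' v, m u = some v → m u' = some v → u = u'

/-- The left vertices not covered by `m`. -/
def unmatched (m : Fin n → Option (Fin n)) : Finset (Fin n) :=
  univ.filter fun u => m u = none

theorem mem_unmatched {m : Fin n → Option (Fin n)} {u : Fin n} : u ∈ unmatched m ↔ m u = none := by
  simp [unmatched]

theorem IsPartialMatching.exists_perfect {E : Finset (Fin n × Fin n)} {m : Fin n → Option (Fin n)}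
    (h : IsPartialMatching E m) (hm : unmatched m = ∅) : ∃ σ, IsPerfectMatchingFun E σ := by
  have hex : ∀ u, ∃ v, m u = some v := fun u => by
    rw [← Option.ne_none_iff_exists']
    intro hu
    simpa [hm] using mem_unmatched.2 hu
  choose σ hσ using hex
  exact ⟨σ, fun i j hij => h.inj i j (σ i) (hσ i) (hij ▸ hσ j), fun i => h.edge _ _ (hσ i)⟩

/-! ### The auction phase -/

/-- The invariant of the auction: each matched vertex holds a vertex of nearly least price. -/
structure AuctionInv (E : Finset (Fin n × Fin n))
    (s : (Fin n → Option (Fin n)) × (Fin n → ℕ)) : Prop where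
  matching : IsPartialMatching E s.1
  happy : ∀ u v v', s.1 u = some v → (u, v') ∈ E → s.2 v ≤ s.2 v' + 1
  sold : ∀ v, s.2 v ≠ 0 → ∃ u, s.1 u = some v

/-- The unmatched vertex `u` buys `v`, whose price rises by one. -/
def auctionStep (s : (Fin n → Option (Fin n)) × (Fin n → ℕ)) :
    Option (Fin n × Fin n) → (Fin n → Option (Fin n)) × (Fin n → ℕ)
  | none => s
  | some (u, v) => (fun x => if x = u then some v else if s.1 x = some v then none else s.1 x,
      Function.update s.2 v (s.2 v + 1))

/-- An edge from an unmatched vertex to a vertex of price below `k` weighs that price. -/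
def auctionWeight (k : ℕ) (s : (Fin n → Option (Fin n)) × (Fin n → ℕ)) (e : Fin n × Fin n) : ℕ∞ :=
  if s.1 e.1 = none ∧ s.2 e.2 < k then (s.2 e.2 : ℕ∞) else ⊤

/-- The buyer takes a cheapest neighbour and prices never fall, so near-optimality persists; a
displaced owner just becomes unmatched. Only vertices of price below `k` are sold, so each sale
lowers the potential. -/
theorem AuctionInv.step {E : Finset (Fin n × Fin n)} {k : ℕ}
    {s : (Fin n → Option (Fin n)) × (Fin n → ℕ)} (hs : AuctionInv E s)
    {a : Option (Fin n × Fin n)} (ha : IsMinElement E (auctionWeight k s) a) :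
    (auctionStep s a = s ∧ ∀ u v, (u, v) ∈ E → s.1 u = none → k ≤ s.2 v) ∨
      (AuctionInv E (auctionStep s a) ∧
        ∑ v, (k - (auctionStep s a).2 v) < ∑ v, (k - s.2 v)) := by
  obtain ⟨m, p⟩ := s
  rcases a with _ | ⟨u, v⟩
  · left
    refine ⟨rfl, fun u v huv hu => ?_⟩
    by_contra hlt
    have := ha (u, v) huv
    rw [auctionWeight, if_pos ⟨hu, not_le.1 hlt⟩] at this
    exact ENat.natCast_ne_top _ this
  right
  obtain ⟨huv, hw, hmin⟩ := ha
  have hc : m u = none ∧ p v < k := by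
    by_contra hc
    exact hw (if_neg hc)
  obtain ⟨hu, hv⟩ := hc
  have hle : ∀ v', (u, v') ∈ E → p v ≤ p v' := fun v' hv' => by
    by_cases hk : p v' < k
    · have := hmin _ hv'
      simp only [auctionWeight, hu, hv, hk, and_self, if_true] at this
      exact_mod_cast this
    -- Here `p v < k ≤ p v'`.
    · omega
  have hmono : ∀ v', p v' ≤ Function.update p v (p v + 1) v' := fun v' => by
    by_cases h : v' = v
    · subst h; simp
    · simp [h]
  have hm : ∀ x y, (if x = u then some v else if m x = some v then none else m x) = some y →
      (x = u ∧ y = v) ∨ (x ≠ u ∧ y ≠ v ∧ m x = some y) := by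
    intro x y h
    split_ifs at h with h1 h2
    · exact Or.inl ⟨h1, (Option.some.inj h).symm⟩
    · exact Or.inr ⟨h1, fun h3 => h2 (h3 ▸ h), h⟩
  have hI := hs.matching
  refine ⟨⟨⟨?_, ?_⟩, ?_, ?_⟩, ?_⟩
  · intro x y h
    rcases hm x y h with ⟨rfl, rfl⟩ | ⟨-, -, h⟩
    · exact huv
    · exact hI.edge _ _ h
  · intro x x' y h h'
    rcases hm x y h with ⟨rfl, rfl⟩ | ⟨-, h1, h⟩ <;> rcases hm x' y h' with ⟨rfl, h2⟩ | ⟨-, h2, h'⟩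
    · rfl
    · exact absurd rfl h2
    · exact absurd h2 h1
    · exact hI.inj _ _ _ h h'
  · intro x y v' h hE
    have hmv := hmono v'
    rcases hm x y h with ⟨rfl, rfl⟩ | ⟨-, h1, h⟩
    · have := hle v' hE
      simp only [auctionStep, Function.update_self] at hmv ⊢
      omega
    · have := hs.happy x y v' h hE
      simp only [auctionStep, Function.update_of_ne h1] at this ⊢
      omega
  · intro y hy
    by_cases hyv : y = v
    · exact ⟨u, by simp [auctionStep, hyv]⟩
    · simp only [auctionStep, Function.update_of_ne hyv] at hy
      obtain ⟨x, hx⟩ := hs.sold y hy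
      have hx : m x = some y := hx
      have hxu : x ≠ u := by rintro rfl; simp [hu] at hx
      exact ⟨x, by simp [auctionStep, hxu, hx, hyv]⟩
  · refine sum_lt_sum (fun y _ => ?_) ⟨v, mem_univ _, ?_⟩
    · exact Nat.sub_le_sub_left (hmono y) k
    · simp only [auctionStep, Function.update_self]; omega

/-- Weak duality: along `σ`, a matched vertex pays at most `s.2 (σ u) + 1`, and an unmatched one
sees a price of at least `k`. Summing over `u`, the prices cancel because every nonzero price is
paid by an owner, and the slack of one per vertex totals `n`. -/
theorem AuctionInv.mul_card_unmatched_le {E : Finset (Fin n × Fin n)} {k : ℕ}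
    {s : (Fin n → Option (Fin n)) × (Fin n → ℕ)} (hs : AuctionInv E s)
    (hdone : ∀ u v, (u, v) ∈ E → s.1 u = none → k ≤ s.2 v)
    {σ : Fin n → Fin n} (hσ : IsPerfectMatchingFun E σ) : k * (unmatched s.1).card ≤ n := by
  have hbij : Function.Bijective σ := Finite.injective_iff_bijective.1 hσ.1
  let q : Fin n → ℕ := fun u => (s.1 u).elim 0 s.2
  have hpoint : ∀ u, (if s.1 u = none then k else 0) + q u ≤ s.2 (σ u) + 1 := fun u => by
    rcases hu : s.1 u with _ | v
    · have := hdone u _ (hσ.2 u) hu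
      simp only [q, hu, Option.elim, if_true]
      omega
    · simpa [q, hu] using hs.happy u v _ hu (hσ.2 u)
  have hsum := sum_le_sum fun u (_ : u ∈ univ) => hpoint u
  have hq : ∑ v, s.2 v ≤ ∑ u, q u := by
    have hv : ∀ v, s.2 v = ∑ u, if s.1 u = some v then s.2 v else 0 := fun v => by
      by_cases h0 : s.2 v = 0
      · simp [h0]
      · obtain ⟨u, hu⟩ := hs.sold v h0
        rw [sum_eq_single u]
        · simp [hu]
        · intro u' _ hne
          rw [if_neg fun h => hne (hs.matching.inj _ _ _ h hu)]
        · simp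
    rw [sum_congr rfl fun v _ => hv v, sum_comm]
    refine sum_le_sum fun u _ => ?_
    rcases hu : s.1 u with _ | v
    · simp
    · simp [q, hu]
  rw [sum_add_distrib, sum_add_distrib, hbij.sum_comp s.2] at hsum
  rw [← sum_filter, sum_const, smul_eq_mul] at hsum
  simp only [sum_const, card_univ, Fintype.card_fin, smul_eq_mul, mul_one] at hsum
  rw [mul_comm]
  change (unmatched s.1).card * k + _ ≤ _ at hsum
  omega

theorem exists_auction_protocol {t : ℕ} (ht : Fintype.card (Option (Fin n × Fin n)) ≤ 2 ^ t)
    (k : ℕ) :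
    ∃ P : CommProtocol (Finset (Fin n × Fin n)) (Finset (Fin n × Fin n)) (Fin n → Option (Fin n)),
      P.cost ≤ n * k * (2 * t) ∧ ∀ A B, IsPartialMatching (A ∪ B) (P.output A B) ∧
        ∀ σ, IsPerfectMatchingFun (A ∪ B) σ → k * (unmatched (P.output A B)).card ≤ n := by
  obtain ⟨P, hc, hP⟩ := exists_query_protocol ht (auctionWeight k) auctionStep (n * k)
    (fun _ => none, fun _ => 0)
  refine ⟨P.bind fun s => .leaf s.1, (P.cost_bind_le _ (c := 0) fun _ => le_rfl).trans hc,
    fun A B => ?_⟩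
  obtain ⟨ans, hans, hout⟩ := hP A B
  obtain ⟨hI, hD⟩ := Function.iterate_of_potential (fun s => auctionStep s (ans s))
    (AuctionInv (A ∪ B)) (fun s => ∀ u v, (u, v) ∈ A ∪ B → s.1 u = none → k ≤ s.2 v)
    (fun s => ∑ v, (k - s.2 v)) (fun s hs => hs.step (hans s)) (n * k)
    (fun _ => none, fun _ => 0) ⟨⟨by simp, by simp⟩, by simp, by simp⟩ (by simp)
  rw [← hout] at hI hD
  rw [CommProtocol.output_bind]
  exact ⟨hI.matching, fun σ hσ => hI.mul_card_unmatched_le hD hσ⟩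

/-! ### The augmentation phase -/

/-- A search state: a matching, the left vertices reached by alternating paths from unmatched ones,
and for each reached vertex the matching obtained by exchange along a path to it. -/
structure SearchState (n : ℕ) where
  m : Fin n → Option (Fin n)
  S : Finset (Fin n)
  M : Fin n → Fin n → Option (Fin n)

/-- The search state in which only the unmatched vertices have been reached. -/
def SearchState.init (m : Fin n → Option (Fin n)) : SearchState n := ⟨m, unmatched m, fun _ => m⟩

open Classical in
/-- Use an edge that leaves the reached vertices to reach another one or to augment. -/
noncomputable def SearchState.step (s : SearchState n) : Option (Fin n × Fin n) → SearchState n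
  | none => s
  | some (u, v) =>
    if h : ∃ x, s.m x = some v then
      ⟨s.m, insert h.choose s.S, Function.update s.M h.choose
        (Function.update (Function.update (s.M u) u (some v)) h.choose none)⟩
    else SearchState.init (Function.update (s.M u) u (some v))

open Classical in
/-- The edges that leave the reached vertices weigh `0`, all others `⊤`. -/
noncomputable def SearchState.weight (s : SearchState n) (e : Fin n × Fin n) : ℕ∞ :=
  if e.1 ∈ s.S ∧ ∀ x ∈ s.S, s.m x ≠ some e.2 then 0 else ⊤

/-- Invariant of the search: exchanges are matchings of constant size that differ from `s.m` only
on reached vertices. -/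
structure SearchState.Inv (E : Finset (Fin n × Fin n)) (s : SearchState n) : Prop where
  matching : IsPartialMatching E s.m
  unmatched_subset : unmatched s.m ⊆ s.S
  matching' : ∀ w ∈ s.S, IsPartialMatching E (s.M w)
  hole : ∀ w ∈ s.S, s.M w w = none
  agree : ∀ w ∈ s.S, ∀ x ∉ s.S, s.M w x = s.m x
  card : ∀ w ∈ s.S, (unmatched (s.M w)).card = (unmatched s.m).card
  range : ∀ w ∈ s.S, ∀ x v, s.M w x = some v → ∃ x', s.m x' = some v

theorem SearchState.inv_init {E : Finset (Fin n × Fin n)} {m : Fin n → Option (Fin n)}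
    (h : IsPartialMatching E m) : (SearchState.init m).Inv E :=
  ⟨h, Subset.rfl, fun _ _ => h, fun _ hw => mem_unmatched.1 hw, fun _ _ _ _ => rfl,
    fun _ _ => rfl, fun _ _ x _ hx => ⟨x, hx⟩⟩

theorem unmatched_update_some (m : Fin n → Option (Fin n)) (u v : Fin n) :
    unmatched (Function.update m u (some v)) = (unmatched m).erase u := by
  ext x
  by_cases h : x = u
  · subst h; simp [mem_unmatched]
  · simp [mem_unmatched, h]

theorem unmatched_update_none (m : Fin n → Option (Fin n)) (w : Fin n) :
    unmatched (Function.update m w none) = insert w (unmatched m) := by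
  ext x
  by_cases h : x = w
  · subst h; simp [mem_unmatched]
  · simp [mem_unmatched, h]

/-- The number of steps that a search state needs at most. -/
def SearchState.potential (s : SearchState n) : ℕ :=
  (unmatched s.m).card * (n + 1) + (n - s.S.card)

/-- When no edge leaves the reached set `S`, `σ` sends `S` into the mates of `S`. This injects `S`
into its matched part, so `S` has no unmatched vertex. -/
theorem SearchState.Inv.unmatched_eq_empty {E : Finset (Fin n × Fin n)} {s : SearchState n}
    (hs : s.Inv E) (h : ∀ e ∈ E, s.weight e = ⊤) {σ : Fin n → Fin n}
    (hσ : IsPerfectMatchingFun E σ) : unmatched s.m = ∅ := by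
  have hex : ∀ i, ∃ x, i ∈ s.S → x ∈ s.S ∧ s.m x = some (σ i) := fun i => by
    by_cases hi : i ∈ s.S
    · have := h _ (hσ.2 i)
      by_contra hc
      push Not at hc
      rw [weight, if_pos ⟨hi, fun x hx => (hc x).2 hx⟩] at this
      exact ENat.zero_ne_top this
    · exact ⟨i, fun h => absurd h hi⟩
  choose f hf using hex
  have hcard : s.S.card ≤ (s.S \ unmatched s.m).card := by
    refine card_le_card_of_injOn f (fun i hi => ?_) fun i hi j hj hij => hσ.1 ?_
    · have := hf i hi
      simp [this.1, mem_unmatched, this.2]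
    · have h1 := (hf i hi).2
      rw [hij, (hf j hj).2] at h1
      exact (Option.some.inj h1).symm
  have h1 := card_sdiff_add_card_eq_card hs.unmatched_subset
  exact card_eq_zero.1 (by omega)

/-- If `v` has a mate `w`, then `w` is unreached, and giving `v` to `u` moves the hole from `u` to
`w`. Otherwise `v` is free in `s.M u` too, by `range`, and the matching grows. The factor `n + 1` in
the potential pays for restarting the search. -/
theorem SearchState.Inv.step {E : Finset (Fin n × Fin n)} {s : SearchState n} (hs : s.Inv E)
    {a : Option (Fin n × Fin n)} (ha : IsMinElement E s.weight a) :
    (s.step a = s ∧ ∀ σ, IsPerfectMatchingFun E σ → unmatched s.m = ∅) ∨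
      ((s.step a).Inv E ∧ (s.step a).potential < s.potential) := by
  rcases a with _ | ⟨u, v⟩
  · exact Or.inl ⟨rfl, fun σ hσ => hs.unmatched_eq_empty ha hσ⟩
  right
  obtain ⟨huv, hw, -⟩ := ha
  have hc : u ∈ s.S ∧ ∀ x ∈ s.S, s.m x ≠ some v := by
    by_contra hc
    exact hw (if_neg hc)
  obtain ⟨hu, hv⟩ := hc
  have hMu := hs.matching' u hu
  have huU : u ∈ unmatched (s.M u) := mem_unmatched.2 (hs.hole u hu)
  by_cases h : ∃ x, s.m x = some v
  · simp only [SearchState.step, dif_pos h]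
    generalize hw' : h.choose = w
    have hmw : s.m w = some v := hw' ▸ h.choose_spec
    have hwS : w ∉ s.S := fun hS => hv w hS hmw
    have hwu : w ≠ u := fun h => hwS (h ▸ hu)
    have hMw : s.M u w = some v := (hs.agree u hu w hwS).trans hmw
    have hne : ∀ y ∈ s.S, y ≠ w := fun y hy h => hwS (h ▸ hy)
    set M' := Function.update (Function.update (s.M u) u (some v)) w none with hM'
    have hval : ∀ x y, M' x = some y → (x = u ∧ y = v) ∨ (x ≠ w ∧ s.M u x = some y) := by
      intro x y hx
      by_cases hxw : x = w
      · simp [hM', hxw] at hx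
      by_cases hxu : x = u
      · rw [hM', Function.update_of_ne hxw, hxu, Function.update_self] at hx
        exact Or.inl ⟨hxu, (Option.some.inj hx).symm⟩
      · rw [hM', Function.update_of_ne hxw, Function.update_of_ne hxu] at hx
        exact Or.inr ⟨hxw, hx⟩
    have hMM : IsPartialMatching E M' := by
      constructor
      · intro x y hx
        rcases hval x y hx with ⟨rfl, rfl⟩ | ⟨-, hx⟩
        · exact huv
        · exact hMu.edge _ _ hx
      · intro x x' y hx hx'
        rcases hval x y hx with ⟨rfl, rfl⟩ | ⟨h1, hx⟩ <;>
          rcases hval x' y hx' with ⟨rfl, h2⟩ | ⟨h2, hx'⟩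
        · rfl
        -- In `s.M u` only `w` holds `v`, and `M'` unmatches `w`.
        · exact absurd (hMu.inj _ _ _ hx' hMw) h2
        · exact absurd (hMu.inj _ _ _ hx (h2 ▸ hMw)) h1
        · exact hMu.inj _ _ _ hx hx'
    have hcard : (unmatched M').card = (unmatched s.m).card := by
      rw [hM', unmatched_update_none, unmatched_update_some, card_insert_of_notMem,
        card_erase_add_one huU, hs.card u hu]
      simp [mem_unmatched, hMw]
    refine ⟨⟨hs.matching, hs.unmatched_subset.trans (subset_insert _ _), ?_, ?_, ?_, ?_, ?_⟩, ?_⟩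
    · intro y hy
      rcases mem_insert.1 hy with rfl | hy
      · simpa only [Function.update_self] using hMM
      · simpa only [Function.update_of_ne (hne y hy)] using hs.matching' y hy
    · intro y hy
      rcases mem_insert.1 hy with rfl | hy
      · simp [hM']
      · simpa only [Function.update_of_ne (hne y hy)] using hs.hole y hy
    · intro y hy x hx
      have hx' := not_or.1 (mt mem_insert.2 hx)
      have hxu : x ≠ u := fun h => hx'.2 (h ▸ hu)
      rcases mem_insert.1 hy with rfl | hy
      · simp only [Function.update_self, hM', Function.update_of_ne hx'.1,
          Function.update_of_ne hxu]
        exact hs.agree u hu x hx'.2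
      · simpa only [Function.update_of_ne (hne y hy)] using hs.agree y hy x hx'.2
    · intro y hy
      rcases mem_insert.1 hy with rfl | hy
      · simpa only [Function.update_self] using hcard
      · simpa only [Function.update_of_ne (hne y hy)] using hs.card y hy
    · intro y hy x z hx
      rcases mem_insert.1 hy with rfl | hy
      · simp only [Function.update_self] at hx
        rcases hval x z hx with ⟨-, rfl⟩ | ⟨-, hx⟩
        · exact h
        · exact hs.range u hu x z hx
      · simp only [Function.update_of_ne (hne y hy)] at hx
        exact hs.range y hy x z hx
    · have hle : (insert w s.S).card ≤ n := by simpa using card_le_univ (insert w s.S)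
      simp only [potential]
      rw [card_insert_of_notMem hwS] at hle ⊢
      omega
  · simp only [SearchState.step, dif_neg h]
    refine ⟨SearchState.inv_init ⟨?_, ?_⟩, ?_⟩
    · intro x y hx
      by_cases hxu : x = u
      · subst hxu
        rw [Function.update_self] at hx
        rwa [← Option.some.inj hx]
      · rw [Function.update_of_ne hxu] at hx
        exact hMu.edge _ _ hx
    · have hno : ∀ x, s.M u x ≠ some v := fun x hx => h (hs.range u hu x v hx)
      intro x x' y hx hx'
      by_cases hxu : x = u <;> by_cases hxu' : x' = u
      · rw [hxu, hxu']
      · rw [hxu, Function.update_self] at hx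
        rw [Function.update_of_ne hxu', ← hx] at hx'
        exact absurd hx' (hno _)
      · rw [hxu', Function.update_self] at hx'
        rw [Function.update_of_ne hxu, ← hx'] at hx
        exact absurd hx (hno _)
      · rw [Function.update_of_ne hxu] at hx
        rw [Function.update_of_ne hxu'] at hx'
        exact hMu.inj _ _ _ hx hx'
    · simp only [potential, init]
      rw [unmatched_update_some]
      have h1 := card_erase_add_one huU
      rw [hs.card u hu] at h1
      rw [← h1, add_mul]
      omega

theorem exists_augment_protocol {t : ℕ} (ht : Fintype.card (Option (Fin n × Fin n)) ≤ 2 ^ t)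
    (m : Fin n → Option (Fin n)) {d : ℕ} (hd : (unmatched m).card ≤ d) :
    ∃ P : CommProtocol (Finset (Fin n × Fin n)) (Finset (Fin n × Fin n)) Bool,
      P.cost ≤ (d + 1) * (n + 1) * (2 * t) ∧ ∀ A B, IsPartialMatching (A ∪ B) m →
        (P.output A B = true ↔ ∃ σ, IsPerfectMatchingFun (A ∪ B) σ) := by
  obtain ⟨P, hc, hP⟩ := exists_query_protocol ht SearchState.weight SearchState.step
    ((d + 1) * (n + 1)) (SearchState.init m)
  refine ⟨P.bind fun s => .leaf (decide (unmatched s.m = ∅)),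
    (P.cost_bind_le _ (c := 0) fun _ => le_rfl).trans hc, fun A B hm => ?_⟩
  obtain ⟨ans, hans, hout⟩ := hP A B
  obtain ⟨hI, hD⟩ := Function.iterate_of_potential (fun s => SearchState.step s (ans s))
    (SearchState.Inv (A ∪ B))
    (fun s => ∀ σ, IsPerfectMatchingFun (A ∪ B) σ → unmatched s.m = ∅)
    SearchState.potential (fun s hs => hs.step (hans s)) ((d + 1) * (n + 1))
    (SearchState.init m) (SearchState.inv_init hm) (by
      have := Nat.mul_le_mul_right (n + 1) hd
      simp only [SearchState.potential, SearchState.init]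
      rw [add_mul d 1]
      omega)
  rw [← hout] at hI hD
  rw [CommProtocol.output_bind]
  simp only [CommProtocol.output, decide_eq_true_eq]
  exact ⟨fun h => hI.matching.exists_perfect h, fun ⟨σ, hσ⟩ => hD σ hσ⟩

/-! ### Combining the two phases and choosing `k`. -/

theorem exists_matching_protocol {t k : ℕ} (ht : Fintype.card (Option (Fin n × Fin n)) ≤ 2 ^ t)
    (hk : 0 < k) :
    ∃ P : CommProtocol (Finset (Fin n × Fin n)) (Finset (Fin n × Fin n)) Bool,
      P.cost ≤ (n * k + (n / k + 1) * (n + 1)) * (2 * t) ∧ P.Computes (matchingProblem n) := by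
  obtain ⟨P, hPc, hP⟩ := exists_auction_protocol ht k
  have hex : ∀ m : Fin n → Option (Fin n),
      ∃ Q : CommProtocol (Finset (Fin n × Fin n)) (Finset (Fin n × Fin n)) Bool,
        Q.cost ≤ (n / k + 1) * (n + 1) * (2 * t) ∧ ∀ A B, IsPartialMatching (A ∪ B) m →
          (∀ σ, IsPerfectMatchingFun (A ∪ B) σ → k * (unmatched m).card ≤ n) →
          (Q.output A B = true ↔ ∃ σ, IsPerfectMatchingFun (A ∪ B) σ) := fun m => by
    by_cases hm : k * (unmatched m).card ≤ n
    · obtain ⟨Q, hQc, hQ⟩ := exists_augment_protocol ht m (d := n / k)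
        ((Nat.le_div_iff_mul_le hk).2 (by rwa [mul_comm]))
      exact ⟨Q, hQc, fun A B h _ => hQ A B h⟩
    -- The auction's matching is public, so too many unmatched vertices already refute a perfect
    -- matching at no cost.
    · exact ⟨.leaf false, Nat.zero_le _, fun A B _ h => by
        simpa [CommProtocol.output] using fun σ hσ => hm (h σ hσ)⟩
  choose Q hQc hQ using hex
  refine ⟨P.bind Q, ?_, fun A B => ?_⟩
  · have := P.cost_bind_le Q hQc
    rw [add_mul]
    omega
  · classical
    rw [CommProtocol.output_bind, matchingProblem, Bool.eq_iff_iff, decide_eq_true_iff,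
      exists_isPerfectMatching_iff]
    exact hQ _ A B (hP A B).1 (hP A B).2

end Matching

theorem detCommComplexity_matchingProblem_le {n : ℕ} (hn : 2 ≤ n) :
    detCommComplexity (matchingProblem n) ≤
      ((8 * n * Nat.sqrt n * (4 * (Nat.log 2 n + 1)) : ℕ) : ℕ∞) := by
  have hk : 0 < Nat.sqrt n := Nat.sqrt_pos.2 (by omega)
  have ht : Fintype.card (Option (Fin n × Fin n)) ≤ 2 ^ (2 * (Nat.log 2 n + 1)) := by
    have h := Nat.lt_pow_succ_log_self (b := 2) (by norm_num) n
    simp only [Fintype.card_option, Fintype.card_prod, Fintype.card_fin]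
    rw [mul_comm 2, pow_mul, pow_two]
    exact Nat.mul_self_lt_mul_self h
  obtain ⟨P, hc, hP⟩ := exists_matching_protocol ht hk
  refine (iInf₂_le P hP).trans (Nat.cast_le.2 (hc.trans ?_))
  -- With `r = Nat.sqrt n`, `n ≤ r * r + 2 * r < (r + 3) * r`.
  have hdiv : n / Nat.sqrt n ≤ Nat.sqrt n + 2 := by
    have hle := Nat.sqrt_le_add n
    have : n / Nat.sqrt n < Nat.sqrt n + 3 := by
      rw [Nat.div_lt_iff_lt_mul hk]
      nlinarith
    omega
  have hsteps : n * Nat.sqrt n + (n / Nat.sqrt n + 1) * (n + 1) ≤ 8 * n * Nat.sqrt n := by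
    have h1 : (n / Nat.sqrt n + 1) * (n + 1) ≤ (Nat.sqrt n + 3) * (n + 1) :=
      Nat.mul_le_mul_right _ (by omega)
    nlinarith
  calc _ ≤ 8 * n * Nat.sqrt n * (2 * (2 * (Nat.log 2 n + 1))) := Nat.mul_le_mul_right _ hsteps
    _ = _ := by ring

theorem mainTheorem3 :
    ∃ C : ℝ, 0 < C ∧ ∀ n : ℕ, 2 ≤ n →
      (detCommComplexity (matchingProblem n) : ℝ≥0∞) ≤
        ENNReal.ofReal (C * (n : ℝ) ^ (3 / 2 : ℝ) * Real.log (n : ℝ)) := by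
  -- `128 = 8 * 16`: the factor 8 counts queries, and 16 bounds the bits per query against `Real.log
  -- n`.
  refine ⟨128, by norm_num, fun n hn => ?_⟩
  refine (ENat.toENNReal_le.2 (detCommComplexity_matchingProblem_le hn)).trans ?_
  rw [ENat.toENNReal_coe, ← ENNReal.ofReal_natCast]
  refine ENNReal.ofReal_le_ofReal ?_
  have hn' : (2 : ℝ) ≤ n := by exact_mod_cast hn
  have hpow : (n : ℝ) ^ (3 / 2 : ℝ) = n * Real.sqrt n := by
    rw [Real.sqrt_eq_rpow, show (3 / 2 : ℝ) = 1 + 1 / 2 by norm_num,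
      Real.rpow_add (by linarith), Real.rpow_one]
  have hsqrt : (Nat.sqrt n : ℝ) ≤ Real.sqrt n := Real.nat_sqrt_le_real_sqrt
  have hl2 : (1 / 2 : ℝ) < Real.log 2 := by linarith [Real.log_two_gt_d9]
  have hlog2 : Real.log 2 ≤ Real.log n := Real.log_le_log (by norm_num) hn'
  have hlog : (Nat.log 2 n : ℝ) * Real.log 2 ≤ Real.log n := by
    rw [← Real.log_pow]
    exact Real.log_le_log (by positivity) (by exact_mod_cast Nat.pow_log_le_self 2 (by omega))
  have ht : (4 * ((Nat.log 2 n : ℝ) + 1)) ≤ 16 * Real.log n := by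
    have : (0 : ℝ) ≤ Nat.log 2 n := Nat.cast_nonneg _
    nlinarith
  push_cast
  rw [hpow]
  calc (8 * n * Nat.sqrt n * (4 * ((Nat.log 2 n : ℝ) + 1)) : ℝ)
      ≤ 8 * n * Real.sqrt n * (16 * Real.log n) := by gcongr
    _ = _ := by ring
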